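/- Let $t\in\mathbb N$ and let $S_t$ be the symmetric group on $t$ letters, with identity $e$. For $\sigma\in S_t$ let $|\sigma|$ be the number of cycles of $\sigma$, fixed points included. For a partition $\lambda$ of $t$ (written $\lambda\vdash t$) let $\chi_\lambda:S_t\to\mathbb C$ be the irreducible character of $S_t$ attached to $\lambda$ (the character of the Specht module of $\lambda$). Let $N$ be an indeterminate, let $\mathbb C(N)$ be the field of rational functions in $N$, and put $$f_\lambda(N):=\sum_{\sigma\in S_t}\frac{\chi_\lambda(\sigma)\,N^{|\sigma|}}{\chi_\lambda(e)}\in\mathbb C[N].$$ Then every $f_\lambda$ is a nonzero polynomial, so that $$V:=\sum_{\lambda\vdash t}\frac{\chi_\lambda(e)}{t!\,f_\lambda(N)}\,\chi_\lambda$$ is a well-defined class function $S_t\to\mathbb C(N)$, and in the group algebra $\mathbb C(N)[S_t]$, with the convolution product $(f*g)(\alpha)=\sum_{\sigma\in S_t}f(\sigma)g(\sigma^{-1}\alpha)$ and unit $\mathbf 1_e$, the function $V$ is the two-sided inverse of $\mathcal N:\sigma\mapsto N^{|\sigma|}$, that is, $$V*\mathcal N=\mathcal N*V=\mathbf 1_e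 .$$ -/

import Mathlib

noncomputable section

namespace SymmetricGroup

/-! ### Irreducible characters of the symmetric group, indexed by partitions -/

/-- The parts of a partition, as a weakly decreasing list `λ₁ ≥ λ₂ ≥ … ≥ λ_k`. -/
def sortedParts {t : ℕ} (lam : t.Partition) : List ℕ :=
  lam.parts.sort (fun a b => b ≤ a)

theorem sortedParts_sortedGE {t : ℕ} (lam : t.Partition) : (sortedParts lam).SortedGE :=
  (Multiset.pairwise_sort lam.parts (fun a b => b ≤ a)).sortedGE

theorem sum_sortedParts {t : ℕ} (lam : t.Partition) : (sortedParts lam).sum = t := by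
  have h := congrArg Multiset.sum (Multiset.sort_eq lam.parts (fun a b => b ≤ a))
  rw [Multiset.sum_coe, lam.parts_sum] at h
  exact h

/-- The Young diagram of a partition: its `i`-th row consists of the cells `(i, j)` with
`j < λ_{i+1}` (rows and columns are numbered from `0`). -/
def diagram {t : ℕ} (lam : t.Partition) : YoungDiagram :=
  YoungDiagram.ofRowLens (sortedParts lam) (sortedParts_sortedGE lam)

theorem card_cellsOfRowLens (w : List ℕ) :
    (YoungDiagram.cellsOfRowLens w).card = w.sum := by
  induction w with
  | nil => rfl
  | cons a w ih =>
    rw [YoungDiagram.cellsOfRowLens, Finset.card_union_of_disjoint, Finset.card_map, ih]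
    · simp
    · rw [Finset.disjoint_left]
      rintro ⟨i, j⟩ h h'
      simp only [Finset.mem_product, Finset.mem_singleton, Finset.mem_map] at h h'
      obtain ⟨⟨i', j'⟩, -, h2⟩ := h'
      have h3 : i'.succ = i := congrArg Prod.fst h2
      omega

theorem card_diagram {t : ℕ} (lam : t.Partition) : (diagram lam).cells.card = t :=
  (card_cellsOfRowLens _).trans (sum_sortedParts lam)

/-- The cell of the diagram of `lam` that holds the entry `k` in the row-reading tableau: the
cells are filled with the entries `0, 1, …, t - 1` from left to right, row after row
(the lexicographic order on `ℕ × ℕ`). -/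
def cell {t : ℕ} (lam : t.Partition) (k : Fin t) : ℕ × ℕ :=
  ofLex (((diagram lam).cells.map toLex.toEmbedding).orderEmbOfFin
    ((Finset.card_map _).trans (card_diagram lam)) k)

/-- The row group of the tableau: the permutations that preserve each of its rows. -/
def rowGroup {t : ℕ} (lam : t.Partition) : Subgroup (Equiv.Perm (Fin t)) where
  carrier := {p | ∀ k, (cell lam (p k)).1 = (cell lam k).1}
  one_mem' := fun _ => rfl
  mul_mem' := fun {p q} hp hq k => (hp (q k)).trans (hq k)
  inv_mem' := fun {p} hp k => by
    have h := hp (p⁻¹ k)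
    rw [show p (p⁻¹ k) = k from p.apply_symm_apply k] at h
    exact h.symm

/-- The column group of the tableau: the permutations that preserve each of its columns. -/
def columnGroup {t : ℕ} (lam : t.Partition) : Subgroup (Equiv.Perm (Fin t)) where
  carrier := {p | ∀ k, (cell lam (p k)).2 = (cell lam k).2}
  one_mem' := fun _ => rfl
  mul_mem' := fun {p q} hp hq k => (hp (q k)).trans (hq k)
  inv_mem' := fun {p} hp k => by
    have h := hp (p⁻¹ k)
    rw [show p (p⁻¹ k) = k from p.apply_symm_apply k] at h
    exact h.symm

open Classical in
/-- The Young symmetrizer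
`c_λ = (∑_{p in the row group} p) * (∑_{q in the column group} sgn(q) q)` in `ℂ[S_t]`. -/
def youngSymmetrizer {t : ℕ} (lam : t.Partition) :
    MonoidAlgebra ℂ (Equiv.Perm (Fin t)) :=
  (∑ p : Equiv.Perm (Fin t) with p ∈ rowGroup lam, MonoidAlgebra.single p (1 : ℂ)) *
    (∑ q : Equiv.Perm (Fin t) with q ∈ columnGroup lam,
      MonoidAlgebra.single q (((Equiv.Perm.sign q : ℤˣ) : ℤ) : ℂ))

/-- The Specht module of `lam`: the left ideal `ℂ[S_t] c_λ`. -/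
abbrev spechtModule {t : ℕ} (lam : t.Partition) :
    Submodule (MonoidAlgebra ℂ (Equiv.Perm (Fin t))) (MonoidAlgebra ℂ (Equiv.Perm (Fin t))) :=
  Submodule.span (MonoidAlgebra ℂ (Equiv.Perm (Fin t))) {youngSymmetrizer lam}

/-- The irreducible representation of `S_t` attached to `lam`: left multiplication on the
Specht module. -/
def spechtRep {t : ℕ} (lam : t.Partition) :
    Representation ℂ (Equiv.Perm (Fin t)) (spechtModule lam) :=
  ((Algebra.lsmul ℂ ℂ (spechtModule lam)).toRingHom.toMonoidHom).comp
    (MonoidAlgebra.of ℂ (Equiv.Perm (Fin t)))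

/-- The irreducible character `χ_λ` of `S_t`. -/
def chi {t : ℕ} (lam : t.Partition) (σ : Equiv.Perm (Fin t)) : ℂ :=
  (spechtRep lam).character σ

/-! ### The functions `𝒩` and `V` -/

/-- `|σ|`: the number of cycles of `σ`, fixed points included. -/
def numCycles {t : ℕ} (σ : Equiv.Perm (Fin t)) : ℕ :=
  σ.partition.parts.card

/-- The polynomial `f_λ(N) = ∑_σ χ_λ(σ) N^{|σ|} / χ_λ(e)` in the variable `N`. -/
def fPoly {t : ℕ} (lam : t.Partition) : Polynomial ℂ :=
  ∑ σ : Equiv.Perm (Fin t),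
    Polynomial.C (chi lam σ / chi lam 1) * Polynomial.X ^ numCycles σ

/-- The function `𝒩 : σ ↦ N^{|σ|}` on `S_t`, with values in `ℂ(N)`. -/
def cycleFun (t : ℕ) (σ : Equiv.Perm (Fin t)) : RatFunc ℂ :=
  RatFunc.X ^ numCycles σ

/-- The function `V = ∑_λ χ_λ(e) / (t! f_λ(N)) χ_λ` on `S_t`, with values in `ℂ(N)`. -/
def vFun (t : ℕ) (σ : Equiv.Perm (Fin t)) : RatFunc ℂ :=
  ∑ lam : t.Partition,
    RatFunc.C (chi lam 1) /
      ((t.factorial : RatFunc ℂ) * algebraMap (Polynomial ℂ) (RatFunc ℂ) (fPoly lam)) *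
        RatFunc.C (chi lam σ)

/-- A `ℂ(N)`-valued function on `S_t` as the element `∑_σ F(σ) σ` of the group algebra
`ℂ(N)[S_t]`, whose multiplication is convolution. -/
def toGroupAlgebra {t : ℕ} (F : Equiv.Perm (Fin t) → RatFunc ℂ) :
    MonoidAlgebra (RatFunc ℂ) (Equiv.Perm (Fin t)) :=
  ∑ σ : Equiv.Perm (Fin t), MonoidAlgebra.single σ (F σ)

end SymmetricGroup

end

/-! ### Tableau combinatorics: comparing the rows of one tableau with the columns of another. -/

namespace SymmetricGroup

/-! Let `c_λ` be the Young symmetrizer and let `z_λ = ∑_g g c_λ g⁻¹` (`centralElement`). The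
combinatorics of tableaux gives `c_λ x c_λ ∈ ℂ c_λ` for all `x`, and, for `λ ≠ μ`, that `c_λ x c_μ`
vanishes for all `x` or `c_μ x c_λ` does. Since `c_λ` has coefficient 1 at the identity, `c_λ² = n_λ
c_λ` with `n_λ ≠ 0`. Hence the central elements satisfy `z_λ z_μ = 0` and `z_λ² = n_λ² z_λ`. They
are linearly independent, and there are as many of them as cycle types, so they span the class
functions (`span_centralElement`), and `1 = ∑_λ n_λ⁻² z_λ` (`sum_centralElement`).

A trace computation on the left ideal of `c_λ` gives `n_λ χ_λ(σ) = z_λ(σ)` (`youngScalar_mul_chi`).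
Any class function therefore acts on `z_λ` by a scalar, which is read off from the coefficients at
the identity; for `𝒩` this scalar is `f_λ(N)`. As `z_λ(e) = t!`, the character formula turns `V`
into `∑_λ f_λ⁻¹ n_λ⁻² z_λ`, so `𝒩 * V = ∑_λ n_λ⁻² z_λ = 1`. The division is legitimate because `f_λ`
has coefficient 1 at `N^t`: only the identity has `t` cycles. -/

/-- With `m = |S|`, the sets `S \ range m` and `range m \ S` have the same size; the elements of the
first are at least `m`, those of the second at most `m - 1`. The two sums thus differ by at least
that common size. -/
theorem sum_range_card_le (S : Finset ℕ) :
    ∑ r ∈ Finset.range S.card, r ≤ ∑ r ∈ S, r ∧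
      (∑ r ∈ Finset.range S.card, r = ∑ r ∈ S, r → S = Finset.range S.card) := by
  set m := S.card with hm
  have hcard : (S \ Finset.range m).card = (Finset.range m \ S).card := by
    have h1 := Finset.card_sdiff_add_card_inter S (Finset.range m)
    have h2 := Finset.card_sdiff_add_card_inter (Finset.range m) S
    rw [Finset.inter_comm] at h2
    rw [Finset.card_range] at h2
    omega
  have hS := Finset.sum_inter_add_sum_sdiff S (Finset.range m) (fun r => r)
  have hR := Finset.sum_inter_add_sum_sdiff (Finset.range m) S (fun r => r)
  rw [Finset.inter_comm] at hR
  have hlow : (S \ Finset.range m).card * m ≤ ∑ r ∈ S \ Finset.range m, r := by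
    rw [← smul_eq_mul]
    refine Finset.card_nsmul_le_sum _ _ _ fun r hr => ?_
    simp only [Finset.mem_sdiff, Finset.mem_range, not_lt] at hr
    exact hr.2
  have hup : ∑ r ∈ Finset.range m \ S, (r + 1) ≤ (Finset.range m \ S).card * m := by
    rw [← smul_eq_mul]
    refine Finset.sum_le_card_nsmul _ _ _ fun r hr => ?_
    simp only [Finset.mem_sdiff, Finset.mem_range] at hr
    exact hr.1
  rw [Finset.sum_add_distrib, Finset.sum_const, smul_eq_mul, mul_one] at hup
  rw [hcard] at hlow
  refine ⟨by omega, fun h => ?_⟩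
  have h0 : (Finset.range m \ S).card = 0 := by omega
  refine Finset.Subset.antisymm ?_ ?_
  · exact Finset.sdiff_eq_empty_iff_subset.1 (Finset.card_eq_zero.1 (hcard.trans h0))
  · exact Finset.sdiff_eq_empty_iff_subset.1 (Finset.card_eq_zero.1 h0)

variable {t : ℕ}

theorem cell_injective (lam : t.Partition) : Function.Injective (cell lam) := by
  intro x y h
  exact (Finset.orderEmbOfFin _ _).injective (ofLex.injective h)

theorem cell_mem (lam : t.Partition) (k : Fin t) : cell lam k ∈ diagram lam := by
  have h := Finset.orderEmbOfFin_mem ((diagram lam).cells.map toLex.toEmbedding)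
    ((Finset.card_map _).trans (card_diagram lam)) k
  obtain ⟨c, hc, h2⟩ := Finset.mem_map.1 h
  have : cell lam k = c := by
    rw [cell, ← h2]; rfl
  rw [this]
  exact hc

theorem image_cell (lam : t.Partition) : Finset.univ.image (cell lam) = (diagram lam).cells := by
  apply Finset.eq_of_subset_of_card_le
  · intro c hc
    obtain ⟨k, -, rfl⟩ := Finset.mem_image.1 hc
    exact cell_mem lam k
  · rw [Finset.card_image_of_injective _ (cell_injective lam), card_diagram]
    simp

theorem exists_cell_eq (lam : t.Partition) {c : ℕ × ℕ} (hc : c ∈ diagram lam) :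
    ∃ k, cell lam k = c := by
  have : c ∈ Finset.univ.image (cell lam) := by rw [image_cell]; exact hc
  simpa using this

theorem diagram_injective : Function.Injective (diagram : t.Partition → YoungDiagram) := by
  intro lam mu h
  have hpos : ∀ nu : t.Partition, ∀ x ∈ sortedParts nu, 0 < x := fun nu x hx =>
    nu.parts_pos ((Multiset.mem_sort _).1 hx)
  have h1 : sortedParts lam = sortedParts mu := by
    have h2 := congrArg YoungDiagram.rowLens h
    rwa [diagram, diagram, YoungDiagram.rowLens_ofRowLens_eq_self (hpos lam),
      YoungDiagram.rowLens_ofRowLens_eq_self (hpos mu)] at h2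
  apply Nat.Partition.ext
  rw [← Multiset.sort_eq lam.parts (fun a b => b ≤ a),
    ← Multiset.sort_eq mu.parts (fun a b => b ≤ a)]
  exact congrArg _ h1

/-- The permutation `g` takes distinct entries of a row of the tableau of `lam` to distinct columns
of the tableau of `mu`. -/
def SeparatesRows (lam mu : t.Partition) (g : Equiv.Perm (Fin t)) : Prop :=
  ∀ x y, (cell lam x).1 = (cell lam y).1 → (cell mu (g x)).2 = (cell mu (g y)).2 → x = y

/-- The sum of the row indices over the cells of the diagram. -/
def rowSum (lam : t.Partition) : ℕ := ∑ x, (cell lam x).1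

theorem card_column (mu : t.Partition) (g : Equiv.Perm (Fin t)) (j : ℕ) :
    (Finset.univ.filter fun x => (cell mu (g x)).2 = j).card = (diagram mu).colLen j := by
  rw [YoungDiagram.colLen_eq_card]
  refine Finset.card_bij (fun x _ => cell mu (g x)) ?_ ?_ ?_
  · intro x hx
    simp only [Finset.mem_filter, Finset.mem_univ, true_and] at hx
    exact YoungDiagram.mem_col_iff.2 ⟨cell_mem _ _, hx⟩
  · intro x _ y _ h
    exact g.injective (cell_injective mu h)
  · intro c hc
    obtain ⟨h1, h2⟩ := YoungDiagram.mem_col_iff.1 hc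
    obtain ⟨k, rfl⟩ := exists_cell_eq mu h1
    exact ⟨g⁻¹ k, by simpa using h2, by simp⟩

theorem card_row (lam : t.Partition) (i : ℕ) :
    (Finset.univ.filter fun x => (cell lam x).1 = i).card = (diagram lam).rowLen i := by
  rw [YoungDiagram.rowLen_eq_card]
  refine Finset.card_bij (fun x _ => cell lam x) ?_ ?_ ?_
  · intro x hx
    simp only [Finset.mem_filter, Finset.mem_univ, true_and] at hx
    exact YoungDiagram.mem_row_iff.2 ⟨cell_mem _ _, hx⟩
  · intro x _ y _ h
    exact cell_injective lam h
  · intro c hc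
    obtain ⟨h1, h2⟩ := YoungDiagram.mem_row_iff.1 hc
    obtain ⟨k, rfl⟩ := exists_cell_eq lam h1
    exact ⟨k, by simpa using h2, by simp⟩

/-- The entries that `g` sends to column `j` of `mu` lie in distinct rows of `lam`, so their row
indices form a set to which `sum_range_card_le` applies; at equality this set is an initial segment.
-/
theorem sum_column_ge {lam mu : t.Partition} {g : Equiv.Perm (Fin t)}
    (hg : SeparatesRows lam mu g) (j : ℕ) :
    ∑ r ∈ Finset.range ((diagram mu).colLen j), r ≤
        ∑ x with (cell mu (g x)).2 = j, (cell lam x).1 ∧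
      (∑ r ∈ Finset.range ((diagram mu).colLen j), r =
        ∑ x with (cell mu (g x)).2 = j, (cell lam x).1 →
        ∀ x, (cell mu (g x)).2 = j → ((cell lam x).1, j) ∈ diagram mu) := by
  have hinj : Set.InjOn (fun x => (cell lam x).1)
      (Finset.univ.filter fun x => (cell mu (g x)).2 = j : Finset (Fin t)) := by
    intro x hx y hy h
    simp only [Finset.coe_filter, Finset.mem_univ, true_and, Set.mem_ofPred_eq] at hx hy
    exact hg x y h (hx.trans hy.symm)
  have key := sum_range_card_le
    ((Finset.univ.filter fun x => (cell mu (g x)).2 = j).image fun x => (cell lam x).1)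
  rw [Finset.card_image_of_injOn hinj, card_column, Finset.sum_image hinj] at key
  refine ⟨key.1, fun h x hx => ?_⟩
  have h1 := key.2 h
  rw [YoungDiagram.mem_iff_lt_colLen, ← Finset.mem_range, ← h1]
  exact Finset.mem_image.2 ⟨x, by simpa using hx, rfl⟩

theorem sum_column_eq (mu : t.Partition) (j : ℕ) :
    ∑ x with (cell mu x).2 = j, (cell mu x).1 = ∑ r ∈ Finset.range ((diagram mu).colLen j), r := by
  have hinj : Set.InjOn (fun x => (cell mu x).1)
      (Finset.univ.filter fun x => (cell mu x).2 = j : Finset (Fin t)) := by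
    intro x hx y hy h
    simp only [Finset.coe_filter, Finset.mem_univ, true_and, Set.mem_ofPred_eq] at hx hy
    exact cell_injective mu (Prod.ext h (hx.trans hy.symm))
  rw [← Finset.sum_image (f := fun r => r) hinj]
  refine Finset.sum_congr (Finset.ext fun r => ?_) fun _ _ => rfl
  simp only [Finset.mem_image, Finset.mem_filter, Finset.mem_univ, true_and, Finset.mem_range]
  constructor
  · rintro ⟨x, rfl, rfl⟩
    exact YoungDiagram.mem_iff_lt_colLen.1 (cell_mem mu x)
  · intro h
    obtain ⟨k, hk⟩ := exists_cell_eq mu (YoungDiagram.mem_iff_lt_colLen.2 h)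
    exact ⟨k, by rw [hk], by rw [hk]⟩

/-- Sum `sum_column_ge` over the columns of `mu`. The numerical statistic `rowSum` plays the part
usually given to the dominance order. -/
theorem SeparatesRows.rowSum_le {lam mu : t.Partition} {g : Equiv.Perm (Fin t)}
    (hg : SeparatesRows lam mu g) :
    rowSum mu ≤ rowSum lam ∧
      (rowSum mu = rowSum lam → ∀ x, ((cell lam x).1, (cell mu (g x)).2) ∈ diagram mu) := by
  have h1 : rowSum mu = ∑ j ∈ Finset.univ.image fun x => (cell mu x).2,
      ∑ r ∈ Finset.range ((diagram mu).colLen j), r := by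
    rw [rowSum, ← Finset.sum_fiberwise_of_maps_to (g := fun x => (cell mu x).2)
      (t := Finset.univ.image fun x => (cell mu x).2) (by simp)]
    exact Finset.sum_congr rfl fun j _ => sum_column_eq mu j
  have h2 : rowSum lam = ∑ j ∈ Finset.univ.image fun x => (cell mu x).2,
      ∑ x with (cell mu (g x)).2 = j, (cell lam x).1 := by
    rw [rowSum, ← Finset.sum_fiberwise_of_maps_to (g := fun x => (cell mu (g x)).2)
      (t := Finset.univ.image fun x => (cell mu x).2) (by simp)]
  have hle : ∀ j ∈ Finset.univ.image fun x => (cell mu x).2,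
      ∑ r ∈ Finset.range ((diagram mu).colLen j), r ≤
        ∑ x with (cell mu (g x)).2 = j, (cell lam x).1 := fun j _ => (sum_column_ge hg j).1
  rw [h1, h2]
  refine ⟨Finset.sum_le_sum hle, fun h x => ?_⟩
  exact (sum_column_ge hg _).2
    ((Finset.sum_eq_sum_iff_of_le hle).1 h _ (Finset.mem_image_of_mem _ (Finset.mem_univ (g x))))
    x rfl

/-- Pairing the row of `x` in `lam` with the column of `g x` in `mu` is injective into the cells of
`mu`, hence bijective by counting. It preserves row indices, so the two diagrams have equal row
lengths. -/
theorem SeparatesRows.eq_of_rowSum_eq {lam mu : t.Partition} {g : Equiv.Perm (Fin t)}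
    (hg : SeparatesRows lam mu g) (h : rowSum mu = rowSum lam) : lam = mu := by
  have hmem := hg.rowSum_le.2 h
  have hinj : Function.Injective fun x => ((cell lam x).1, (cell mu (g x)).2) := fun x y hxy =>
    hg x y (Prod.ext_iff.1 hxy).1 (Prod.ext_iff.1 hxy).2
  have himg : Finset.univ.image (fun x => ((cell lam x).1, (cell mu (g x)).2)) =
      (diagram mu).cells := by
    apply Finset.eq_of_subset_of_card_le
    · intro c hc
      obtain ⟨k, -, rfl⟩ := Finset.mem_image.1 hc
      exact hmem k
    · rw [Finset.card_image_of_injective _ hinj, card_diagram]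
      simp
  have hrow : ∀ i, (diagram lam).rowLen i = (diagram mu).rowLen i := by
    intro i
    rw [← card_row, YoungDiagram.rowLen_eq_card]
    refine Finset.card_bij (fun x _ => ((cell lam x).1, (cell mu (g x)).2)) ?_ ?_ ?_
    · intro x hx
      simp only [Finset.mem_filter, Finset.mem_univ, true_and] at hx
      exact YoungDiagram.mem_row_iff.2 ⟨hmem x, hx⟩
    · intro x _ y _ hxy
      exact hinj hxy
    · intro c hc
      obtain ⟨h1, h2⟩ := YoungDiagram.mem_row_iff.1 hc
      rw [← YoungDiagram.mem_cells, ← himg] at h1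
      obtain ⟨k, -, rfl⟩ := Finset.mem_image.1 h1
      exact ⟨k, by simpa using h2, rfl⟩
  apply diagram_injective
  apply YoungDiagram.ext
  ext ⟨i, j⟩
  rw [YoungDiagram.mem_cells, YoungDiagram.mem_cells, YoungDiagram.mem_iff_lt_rowLen,
    YoungDiagram.mem_iff_lt_rowLen, hrow]

theorem eq_of_separatesRows {lam mu : t.Partition} {g h : Equiv.Perm (Fin t)}
    (hg : SeparatesRows lam mu g) (hh : SeparatesRows mu lam h) : lam = mu :=
  hg.eq_of_rowSum_eq (le_antisymm hg.rowSum_le.1 hh.rowSum_le.1)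

/-- Von Neumann's lemma. -/
theorem SeparatesRows.exists_mul {lam : t.Partition} {g : Equiv.Perm (Fin t)}
    (hg : SeparatesRows lam lam g⁻¹) :
    ∃ p ∈ rowGroup lam, ∃ q ∈ columnGroup lam, g = p * q := by
  have hmem := hg.rowSum_le.2 rfl
  -- `f x` is the entry of the tableau in the row of `x` and the column of `g⁻¹ x`. The resulting
  -- permutation `u` preserves rows and `u * g` preserves columns, which gives `g = u⁻¹ * (u * g)`.
  choose f hf using fun x => exists_cell_eq lam (hmem x)
  have hinj : Function.Injective f := fun x y hxy => by
    have h := hf x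
    rw [hxy, hf y] at h
    exact (hg y x (Prod.ext_iff.1 h).1 (Prod.ext_iff.1 h).2).symm
  let u : Equiv.Perm (Fin t) := Equiv.ofBijective f (Finite.injective_iff_bijective.1 hinj)
  have hu : ∀ x, u x = f x := fun _ => rfl
  refine ⟨u⁻¹, inv_mem ?_, u * g, ?_, by group⟩
  · intro k
    rw [hu, hf]
  · intro k
    rw [Equiv.Perm.mul_apply, hu, hf]
    simp

end SymmetricGroup

/-! ### Group algebras: averaging over conjugates, traces, class functions and orthogonal central
elements. -/

namespace SymmetricGroup

open MonoidAlgebra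

section GroupAlgebra

variable {G : Type*} [Group G] [Fintype G]

omit [Group G] in
theorem eq_sum_single {R : Type*} [Semiring R] (x : MonoidAlgebra R G) :
    x = ∑ g : G, single g (x.coeff g) := by
  classical
  ext h
  rw [coeff_sum, Finsupp.finsetSum_apply]
  simp [Finsupp.single_apply]

/-- The sum of the conjugates of an element of the group algebra. -/
noncomputable def conjSum (c : MonoidAlgebra ℂ G) : MonoidAlgebra ℂ G :=
  ∑ g : G, single g 1 * c * single g⁻¹ 1

theorem coeff_conjSum (c : MonoidAlgebra ℂ G) (h : G) :
    (conjSum c).coeff h = ∑ g : G, c.coeff (g⁻¹ * h * g) := by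
  simp [conjSum, Finsupp.finsetSum_apply, mul_assoc]

theorem coeff_conjSum_one (c : MonoidAlgebra ℂ G) :
    (conjSum c).coeff 1 = Fintype.card G * c.coeff 1 := by
  simp [coeff_conjSum]

theorem coeff_conjSum_conj (c : MonoidAlgebra ℂ G) (g h : G) :
    (conjSum c).coeff (h * g * h⁻¹) = (conjSum c).coeff g := by
  rw [coeff_conjSum, coeff_conjSum]
  refine Fintype.sum_equiv (Equiv.mulLeft h⁻¹) _ _ fun x => ?_
  simp [mul_assoc]

-- Stated over a general coefficient ring because it serves both the elements `conjSum c` over `ℂ`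
-- and the function `V` over `ℂ(N)`.
omit [Fintype G] in
theorem mul_comm_of_coeff_conj {R : Type*} [CommSemiring R] {z : MonoidAlgebra R G}
    (hz : ∀ g h, z.coeff (h * g * h⁻¹) = z.coeff g) (x : MonoidAlgebra R G) :
    x * z = z * x := by
  induction x using MonoidAlgebra.induction_linear with
  | zero => simp
  | add x y hx hy => rw [add_mul, mul_add, hx, hy]
  | single g r =>
    ext h
    rw [coeff_single_mul_apply, coeff_mul_single_apply, mul_comm]
    congr 1
    rw [← hz (g⁻¹ * h) g]
    simp

theorem conjSum_comm (c x : MonoidAlgebra ℂ G) : x * conjSum c = conjSum c * x :=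
  mul_comm_of_coeff_conj (coeff_conjSum_conj c) x

theorem mul_conjSum_of_comm {z : MonoidAlgebra ℂ G} (hz : ∀ x, x * z = z * x)
    (c : MonoidAlgebra ℂ G) : z * conjSum c = conjSum (z * c) := by
  rw [conjSum, conjSum, Finset.mul_sum]
  refine Finset.sum_congr rfl fun g _ => ?_
  rw [← mul_assoc, ← mul_assoc, ← hz, mul_assoc (single g 1) z]

theorem conjSum_smul (s : ℂ) (c : MonoidAlgebra ℂ G) : conjSum (s • c) = s • conjSum c := by
  simp only [conjSum, Finset.smul_sum, mul_smul_comm, smul_mul_assoc]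

theorem trace_mulLeft_comp_mulRight (a b : MonoidAlgebra ℂ G) :
    LinearMap.trace ℂ _ (LinearMap.mulLeft ℂ a ∘ₗ LinearMap.mulRight ℂ b) =
      ∑ g : G, (a * (single g 1 * b)).coeff g := by
  classical
  rw [LinearMap.trace_eq_matrix_trace ℂ (MonoidAlgebra.basis G ℂ), Matrix.trace]
  refine Finset.sum_congr rfl fun g _ => ?_
  rw [Matrix.diag_apply, LinearMap.toMatrix_apply]
  rfl

/-- If `c² = 0`, right multiplication by `c` is nilpotent and has trace 0; but its trace is `|G|`
times the coefficient of `c` at the identity. -/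
theorem mul_self_ne_zero_of_coeff_one {c : MonoidAlgebra ℂ G} (h1 : c.coeff 1 = 1) :
    c * c ≠ 0 := by
  intro h
  have hnil : IsNilpotent (LinearMap.mulRight ℂ c) := ⟨2, by
    refine LinearMap.ext fun x => ?_
    rw [pow_two, Module.End.mul_apply, LinearMap.mulRight_apply, LinearMap.mulRight_apply,
      mul_assoc, h, mul_zero, LinearMap.zero_apply]⟩
  have htr := (LinearMap.isNilpotent_trace_of_isNilpotent hnil).eq_zero
  have h2 := trace_mulLeft_comp_mulRight 1 c
  rw [LinearMap.mulLeft_one, LinearMap.id_comp, htr] at h2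
  simp [h1, eq_comm] at h2

/-- The character of the left ideal generated by a quasi-idempotent `c`. -/
theorem trace_lsmul_span_singleton {c : MonoidAlgebra ℂ G} {n : ℂ}
    (hc : c * c = n • c) (σ : G) :
    n * LinearMap.trace ℂ (Submodule.span (MonoidAlgebra ℂ G) {c})
      (Algebra.lsmul ℂ ℂ _ (MonoidAlgebra.of ℂ G σ)) = (conjSum c).coeff σ⁻¹ := by
  set S := Submodule.span (MonoidAlgebra ℂ G) {c} with hS
  let i : S →ₗ[ℂ] MonoidAlgebra ℂ G := S.subtype.restrictScalars ℂ
  let p : MonoidAlgebra ℂ G →ₗ[ℂ] S :=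
    (LinearMap.toSpanSingleton (MonoidAlgebra ℂ G) S
      ⟨c, Submodule.mem_span_singleton_self c⟩).restrictScalars ℂ
  have hp : ∀ x, i (p x) = x * c := fun x => rfl
  have hpi : ∀ y : S, p (i y) = n • y := by
    intro y
    obtain ⟨a, ha⟩ := Submodule.mem_span_singleton.1 y.2
    apply Subtype.ext
    change (y : MonoidAlgebra ℂ G) * c = n • (y : MonoidAlgebra ℂ G)
    rw [← ha, smul_eq_mul, mul_assoc, hc, mul_smul_comm]
  let L : S →ₗ[ℂ] S := Algebra.lsmul ℂ ℂ S (MonoidAlgebra.of ℂ G σ)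
  -- Right multiplication by `c` maps the algebra into `S` and acts on `S` as the scalar `n`.
  -- Cyclicity of the trace then moves the computation from `S` to the whole algebra, where the
  -- group elements form a basis.
  have h1 : n • L = p ∘ₗ (i ∘ₗ L) := by
    ext1 y
    exact (hpi (L y)).symm
  have h2 : (i ∘ₗ L) ∘ₗ p =
      LinearMap.mulLeft ℂ (single σ (1 : ℂ)) ∘ₗ LinearMap.mulRight ℂ c := by
    ext1 x
    rfl
  change n * LinearMap.trace ℂ S L = _
  rw [← smul_eq_mul, ← map_smul, h1, LinearMap.trace_comp_comm', h2, trace_mulLeft_comp_mulRight,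
    coeff_conjSum]
  simp [mul_assoc]

/-- The elements of the group algebra whose coefficients form a class function. -/
def classFunctions (G : Type*) [Group G] : Submodule ℂ (MonoidAlgebra ℂ G) where
  carrier := {x | ∀ g h, x.coeff (h * g * h⁻¹) = x.coeff g}
  add_mem' hx hy g h := by simp [hx g h, hy g h]
  zero_mem' _ _ := rfl
  smul_mem' s x hx g h := by simp [hx g h]

/-- A class function factors through any complete conjugacy invariant `κ`. Only this upper bound is
needed, since the orthogonal central elements supply the lower one. -/
theorem finrank_classFunctions_le {J : Type*} [Fintype J] (κ : G → J)
    (hκ : ∀ g h, κ g = κ h → IsConj g h) :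
    Module.finrank ℂ (classFunctions G) ≤ Fintype.card J := by
  let Ψ : (J → ℂ) →ₗ[ℂ] MonoidAlgebra ℂ G :=
    { toFun := fun f => ∑ g : G, single g (f (κ g))
      map_add' := fun f f' => by simp [Finset.sum_add_distrib]
      map_smul' := fun s f => by simp [Finset.smul_sum] }
  have hle : classFunctions G ≤ LinearMap.range Ψ := by
    intro x hx
    have hfac : Function.FactorsThrough (fun g => x.coeff g) κ := by
      intro g h hgh
      obtain ⟨u, hu⟩ := isConj_iff.1 (hκ g h hgh)
      change x.coeff g = x.coeff h
      rw [← hu]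
      exact (hx g u).symm
    refine ⟨Function.extend κ (fun g => x.coeff g) 0, ?_⟩
    change ∑ g : G, single g _ = x
    conv_rhs => rw [eq_sum_single x]
    exact Finset.sum_congr rfl fun g _ => by rw [hfac.extend_apply]
  calc Module.finrank ℂ (classFunctions G) ≤ Module.finrank ℂ (LinearMap.range Ψ) :=
        Submodule.finrank_mono hle
    _ ≤ Module.finrank ℂ (J → ℂ) := LinearMap.finrank_range_le Ψ
    _ = Fintype.card J := Module.finrank_fintype_fun_eq_card ℂ

/-- With `z = conjSum c` central, `n z c = z c² = c z c` is a multiple of `c`, so `z c` is one too.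
The factor is the coefficient of `z c` at the identity, and averaging over conjugates carries it
over to `z²`. -/
theorem conjSum_mul_self {c : MonoidAlgebra ℂ G} {n : ℂ} (hn : n ≠ 0) (h1 : c.coeff 1 = 1)
    (hc : c * c = n • c) (hs : ∀ x, ∃ s : ℂ, c * x * c = s • c) :
    conjSum c * conjSum c = n ^ 2 • conjSum c := by
  have hs' : ∀ x, c * x * c = (c * x * c).coeff 1 • c := by
    intro x
    obtain ⟨s, hx⟩ := hs x
    rw [hx, coeff_smul_apply, h1, smul_eq_mul, mul_one]
  have hsum : (conjSum c * c).coeff 1 = n ^ 2 := by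
    calc (conjSum c * c).coeff 1 = ∑ g : G, (c * single g⁻¹ 1 * c).coeff g⁻¹ := by
          simp [conjSum, Finset.sum_mul, Finsupp.finsetSum_apply, mul_assoc]
      _ = ∑ g : G, (c * single g 1 * c).coeff g :=
          Fintype.sum_equiv (Equiv.inv G) _
            (fun g => (c * single g 1 * c).coeff g) fun _ => rfl
      -- Since `c g c = s_g c` with `s_g` its coefficient at 1, the coefficient of `c g c` at `g` is
      -- `s_g c(g)`. Linearity then collects the sum into the coefficient of `c³ = n² c` at 1.
      _ = ∑ g : G, (c * single g (c.coeff g) * c).coeff 1 := by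
          refine Finset.sum_congr rfl fun g _ => ?_
          rw [hs', coeff_smul_apply, smul_eq_mul,
            show single g (c.coeff g) = c.coeff g • single g (1 : ℂ) by simp, mul_smul_comm,
            smul_mul_assoc, coeff_smul_apply, smul_eq_mul, mul_comm]
      _ = (c * c * c).coeff 1 := by
          rw [← Finsupp.finsetSum_apply, ← coeff_sum, ← Finset.sum_mul, ← Finset.mul_sum,
            ← eq_sum_single]
      _ = n ^ 2 := by
          rw [hc, smul_mul_assoc, hc, coeff_smul_apply, coeff_smul_apply, h1]
          simp [pow_two]
  have hzc : conjSum c * c = n ^ 2 • c := by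
    have h : ∃ s : ℂ, conjSum c * c = s • c := by
      obtain ⟨s, hx⟩ := hs (conjSum c)
      refine ⟨n⁻¹ * s, ?_⟩
      rw [conjSum_comm, mul_assoc, hc, mul_smul_comm] at hx
      rw [mul_smul, ← hx, smul_smul, inv_mul_cancel₀ hn, one_smul]
    obtain ⟨s, hx⟩ := h
    have := hsum
    rw [hx, coeff_smul_apply, h1, smul_eq_mul, mul_one] at this
    rw [hx, this]
  rw [mul_conjSum_of_comm (conjSum_comm c), hzc, conjSum_smul]

theorem conjSum_mul_conjSum_eq_zero {c d : MonoidAlgebra ℂ G} (h : ∀ x, c * x * d = 0) :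
    conjSum c * conjSum d = 0 := by
  rw [conjSum, conjSum, Finset.sum_mul_sum]
  refine Finset.sum_eq_zero fun g _ => Finset.sum_eq_zero fun g' _ => ?_
  calc single g 1 * c * single g⁻¹ 1 * (single g' 1 * d * single g'⁻¹ 1)
      = single g 1 * (c * (single g⁻¹ 1 * single g' 1) * d) * single g'⁻¹ 1 := by
        simp only [mul_assoc]
    _ = 0 := by rw [h, mul_zero, zero_mul]

variable {ι : Type*} [Fintype ι]

theorem linearIndependent_of_orthogonal {A : Type*} [Ring A] [Algebra ℂ A] {z : ι → A} {n : ι → ℂ}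
    (hz : ∀ i, z i ≠ 0) (hn : ∀ i, n i ≠ 0) (hii : ∀ i, z i * z i = n i • z i)
    (hij : ∀ i j, i ≠ j → z i * z j = 0) : LinearIndependent ℂ z := by
  rw [Fintype.linearIndependent_iff]
  intro a ha j
  have h := congrArg (· * z j) ha
  simp only [Finset.sum_mul, smul_mul_assoc, zero_mul] at h
  rw [Finset.sum_eq_single j (fun i _ hi => by rw [hij i j hi, smul_zero]) (by simp), hii,
    smul_smul] at h
  simpa [hz j, hn j] using h

theorem exists_smul_of_mem_span {A : Type*} [Ring A] [Algebra ℂ A] {z : ι → A} {n : ι → ℂ}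
    (hii : ∀ i, z i * z i = n i • z i) (hij : ∀ i j, i ≠ j → z i * z j = 0) {x : A}
    (hx : x ∈ Submodule.span ℂ (Set.range z)) (j : ι) : ∃ s : ℂ, x * z j = s • z j := by
  obtain ⟨a, rfl⟩ := (Submodule.mem_span_range_iff_exists_fun ℂ).1 hx
  refine ⟨a j * n j, ?_⟩
  rw [Finset.sum_mul, Finset.sum_eq_single j
    (fun i _ hi => by rw [smul_mul_assoc, hij i j hi, smul_zero]) (by simp), smul_mul_assoc, hii,
    smul_smul]

/-- Multiplying an expansion `1 = ∑ a_i z_i` by `z_j` forces `a_j n_j = 1`. -/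
theorem sum_inv_smul_eq_one {A : Type*} [Ring A] [Algebra ℂ A] {z : ι → A} {n : ι → ℂ}
    (hz : ∀ i, z i ≠ 0) (hii : ∀ i, z i * z i = n i • z i)
    (hij : ∀ i j, i ≠ j → z i * z j = 0) (h1 : (1 : A) ∈ Submodule.span ℂ (Set.range z)) :
    ∑ i, (n i)⁻¹ • z i = 1 := by
  obtain ⟨a, ha⟩ := (Submodule.mem_span_range_iff_exists_fun ℂ).1 h1
  rw [← ha]
  refine Finset.sum_congr rfl fun j _ => ?_
  have h := congrArg (· * z j) ha
  simp only [Finset.sum_mul, smul_mul_assoc, one_mul] at h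
  rw [Finset.sum_eq_single j (fun i _ hi => by rw [hij i j hi, smul_zero]) (by simp), hii,
    smul_smul] at h
  have h2 : (a j * n j - 1) • z j = 0 := by rw [sub_smul, h, one_smul, sub_self]
  rw [smul_eq_zero_iff_left (hz j), sub_eq_zero] at h2
  rw [eq_inv_of_mul_eq_one_left h2]

end GroupAlgebra

end SymmetricGroup

/-! ### Young symmetrizers, their central elements and the irreducible characters. -/

namespace SymmetricGroup

open MonoidAlgebra

variable {t : ℕ}

open Classical in
/-- The sum of the row group. -/
noncomputable def rowSymmetrizer (lam : t.Partition) : MonoidAlgebra ℂ (Equiv.Perm (Fin t)) :=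
  ∑ p : Equiv.Perm (Fin t) with p ∈ rowGroup lam, single p (1 : ℂ)

open Classical in
/-- The signed sum of the column group. -/
noncomputable def columnAntisymmetrizer (lam : t.Partition) :
    MonoidAlgebra ℂ (Equiv.Perm (Fin t)) :=
  ∑ q : Equiv.Perm (Fin t) with q ∈ columnGroup lam, single q (((Equiv.Perm.sign q : ℤˣ) : ℤ) : ℂ)

theorem youngSymmetrizer_eq (lam : t.Partition) :
    youngSymmetrizer lam = rowSymmetrizer lam * columnAntisymmetrizer lam := rfl

theorem rowSymmetrizer_mul_single {lam : t.Partition} {p : Equiv.Perm (Fin t)}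
    (hp : p ∈ rowGroup lam) : rowSymmetrizer lam * single p 1 = rowSymmetrizer lam := by
  classical
  rw [rowSymmetrizer, Finset.sum_mul]
  refine Finset.sum_equiv (Equiv.mulRight p) (fun q => ?_) fun q _ => ?_
  · simp [Subgroup.mul_mem_cancel_right _ hp]
  · simp [single_mul_single]

theorem single_mul_columnAntisymmetrizer {lam : t.Partition} {q : Equiv.Perm (Fin t)}
    (hq : q ∈ columnGroup lam) :
    single q 1 * columnAntisymmetrizer lam =
      (((Equiv.Perm.sign q : ℤˣ) : ℤ) : ℂ) • columnAntisymmetrizer lam := by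
  classical
  rw [columnAntisymmetrizer, Finset.mul_sum, Finset.smul_sum]
  refine Finset.sum_equiv (Equiv.mulLeft q) (fun r => ?_) fun r _ => ?_
  · simp [Subgroup.mul_mem_cancel_left _ hq]
  · have h : (((Equiv.Perm.sign q : ℤˣ) : ℤ) : ℂ) * (((Equiv.Perm.sign q : ℤˣ) : ℤ) : ℂ) = 1 := by
      rw [← Int.cast_mul, ← Units.val_mul, Int.units_mul_self, Units.val_one, Int.cast_one]
    simp [single_mul_single, ← mul_assoc, h]

/-- If `p q = 1` with `p` preserving rows and `q` columns, then `p` fixes every cell, so only the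
pair `(1, 1)` contributes. -/
theorem coeff_youngSymmetrizer_one (lam : t.Partition) : (youngSymmetrizer lam).coeff 1 = 1 := by
  classical
  rw [youngSymmetrizer_eq, rowSymmetrizer, columnAntisymmetrizer, Finset.sum_mul_sum]
  simp only [coeff_sum, Finsupp.finsetSum_apply, single_mul_single, coeff_single, one_mul]
  rw [Finset.sum_eq_single 1, Finset.sum_eq_single 1]
  · simp
  · intro q _ hq
    rw [one_mul, Finsupp.single_apply, if_neg hq]
  · intro h
    simp [one_mem] at h
  · intro p hp hp1
    refine Finset.sum_eq_zero fun q hq => ?_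
    rw [Finsupp.single_apply, if_neg]
    intro hpq
    simp only [Finset.mem_filter, Finset.mem_univ, true_and] at hp hq
    refine hp1 (Equiv.ext fun k => cell_injective lam (Prod.ext (hp k) ?_))
    have h2 : p = q⁻¹ := eq_inv_of_mul_eq_one_left hpq
    rw [h2]
    exact (inv_mem hq : q⁻¹ ∈ columnGroup lam) k
  · intro h
    simp [one_mem] at h

/-- Two entries `x ≠ y` in one row of `lam` have preimages under `g` in one column of `mu`. Their
transposition is absorbed by the row sum on the left, and once moved past `g` it changes the sign of
the column sum, so the product equals its own negative. -/
theorem mul_single_mul_eq_zero {lam mu : t.Partition} {g : Equiv.Perm (Fin t)}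
    (hg : ¬ SeparatesRows lam mu g⁻¹) :
    rowSymmetrizer lam * single g 1 * columnAntisymmetrizer mu = 0 := by
  simp only [SeparatesRows, not_forall] at hg
  obtain ⟨x, y, hrow, hcol, hxy⟩ := hg
  have hs : Equiv.swap x y ∈ rowGroup lam := by
    intro k
    rw [Equiv.swap_apply_def]
    split_ifs with h1 h2
    · rw [h1, hrow]
    · rw [h2, hrow]
    · rfl
  have hs' : Equiv.swap (g⁻¹ x) (g⁻¹ y) ∈ columnGroup mu := by
    intro k
    rw [Equiv.swap_apply_def]
    split_ifs with h1 h2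
    · rw [h1, hcol]
    · rw [h2, hcol]
    · rfl
  have hcomm : Equiv.swap x y * g = g * Equiv.swap (g⁻¹ x) (g⁻¹ y) := by
    rw [Equiv.swap_apply_apply]
    group
  have hsign : Equiv.Perm.sign (Equiv.swap (g⁻¹ x) (g⁻¹ y)) = -1 :=
    Equiv.Perm.sign_swap fun h => hxy (g⁻¹.injective h)
  have h : rowSymmetrizer lam * single g 1 * columnAntisymmetrizer mu =
      -(rowSymmetrizer lam * single g 1 * columnAntisymmetrizer mu) := by
    conv_lhs => rw [← rowSymmetrizer_mul_single hs, mul_assoc (rowSymmetrizer lam),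
      single_mul_single, hcomm, ← single_mul_single, ← mul_assoc, mul_assoc _ _
      (columnAntisymmetrizer mu), single_mul_columnAntisymmetrizer hs', hsign]
    simp
  have h2 : (2 : ℂ) • (rowSymmetrizer lam * single g 1 * columnAntisymmetrizer mu) = 0 := by
    rw [two_smul]
    exact eq_neg_iff_add_eq_zero.1 h
  exact (smul_eq_zero_iff_right two_ne_zero).1 h2

/-- Either the product vanishes, or von Neumann's lemma factors `g = p q` and both factors are
absorbed, at the cost of `sgn(q)`. -/
theorem mul_single_mul_eq_smul (lam : t.Partition) (g : Equiv.Perm (Fin t)) :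
    ∃ s : ℂ, rowSymmetrizer lam * single g 1 * columnAntisymmetrizer lam =
      s • youngSymmetrizer lam := by
  by_cases hg : SeparatesRows lam lam g⁻¹
  · obtain ⟨p, hp, q, hq, rfl⟩ := hg.exists_mul
    refine ⟨((Equiv.Perm.sign q : ℤˣ) : ℤ), ?_⟩
    rw [← one_mul (1 : ℂ), ← single_mul_single, ← mul_assoc, rowSymmetrizer_mul_single hp,
      mul_assoc, single_mul_columnAntisymmetrizer hq, mul_smul_comm, youngSymmetrizer_eq]
  · exact ⟨0, by rw [mul_single_mul_eq_zero hg, zero_smul]⟩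

theorem rowSymmetrizer_mul_mul (lam mu : t.Partition) (x : MonoidAlgebra ℂ (Equiv.Perm (Fin t))) :
    rowSymmetrizer lam * x * columnAntisymmetrizer mu =
      ∑ g, x.coeff g • (rowSymmetrizer lam * single g 1 * columnAntisymmetrizer mu) := by
  conv_lhs => rw [eq_sum_single x, Finset.mul_sum, Finset.sum_mul]
  refine Finset.sum_congr rfl fun g _ => ?_
  rw [show single g (x.coeff g) = x.coeff g • single g (1 : ℂ) by simp, mul_smul_comm,
    smul_mul_assoc]

theorem youngSymmetrizer_mul_mul_self (lam : t.Partition)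
    (x : MonoidAlgebra ℂ (Equiv.Perm (Fin t))) :
    ∃ s : ℂ, youngSymmetrizer lam * x * youngSymmetrizer lam = s • youngSymmetrizer lam := by
  choose s hs using mul_single_mul_eq_smul lam
  refine ⟨∑ g, (columnAntisymmetrizer lam * x * rowSymmetrizer lam).coeff g * s g, ?_⟩
  calc youngSymmetrizer lam * x * youngSymmetrizer lam
      = rowSymmetrizer lam * (columnAntisymmetrizer lam * x * rowSymmetrizer lam) *
          columnAntisymmetrizer lam := by simp only [youngSymmetrizer_eq, mul_assoc]
    _ = _ := by
      rw [rowSymmetrizer_mul_mul, Finset.sum_smul]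
      refine Finset.sum_congr rfl fun g _ => ?_
      rw [hs, smul_smul]

theorem youngSymmetrizer_mul_mul_eq_zero {lam mu : t.Partition}
    (h : ∀ g, ¬ SeparatesRows lam mu g) (x : MonoidAlgebra ℂ (Equiv.Perm (Fin t))) :
    youngSymmetrizer lam * x * youngSymmetrizer mu = 0 := by
  calc youngSymmetrizer lam * x * youngSymmetrizer mu
      = rowSymmetrizer lam * (columnAntisymmetrizer lam * x * rowSymmetrizer mu) *
          columnAntisymmetrizer mu := by simp only [youngSymmetrizer_eq, mul_assoc]
    _ = 0 := by
      rw [rowSymmetrizer_mul_mul]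
      exact Finset.sum_eq_zero fun g _ => by rw [mul_single_mul_eq_zero (h _), smul_zero]

/-- By `eq_of_separatesRows`, rows cannot be separated in both directions when the partitions
differ. Centrality allows the product to be taken in whichever order vanishes. -/
theorem conjSum_youngSymmetrizer_mul_eq_zero {lam mu : t.Partition} (hne : lam ≠ mu) :
    conjSum (youngSymmetrizer lam) * conjSum (youngSymmetrizer mu) = 0 := by
  by_cases h : ∃ g, SeparatesRows lam mu g
  · obtain ⟨g, hg⟩ := h
    rw [conjSum_comm]
    exact conjSum_mul_conjSum_eq_zero (youngSymmetrizer_mul_mul_eq_zero fun g' hg' =>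
      hne (eq_of_separatesRows hg hg'))
  · exact conjSum_mul_conjSum_eq_zero (youngSymmetrizer_mul_mul_eq_zero (not_exists.1 h))

theorem exists_youngSymmetrizer_mul_self (lam : t.Partition) :
    ∃ n : ℂ, n ≠ 0 ∧ youngSymmetrizer lam * youngSymmetrizer lam = n • youngSymmetrizer lam := by
  obtain ⟨n, hn⟩ := youngSymmetrizer_mul_mul_self lam 1
  rw [mul_one] at hn
  refine ⟨n, ?_, hn⟩
  rintro rfl
  exact mul_self_ne_zero_of_coeff_one (coeff_youngSymmetrizer_one lam) (by rw [hn, zero_smul])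

/-- The scalar by which the square of the Young symmetrizer differs from the symmetrizer. -/
noncomputable def youngScalar (lam : t.Partition) : ℂ :=
  (exists_youngSymmetrizer_mul_self lam).choose

theorem youngScalar_ne_zero (lam : t.Partition) : youngScalar lam ≠ 0 :=
  (exists_youngSymmetrizer_mul_self lam).choose_spec.1

theorem youngSymmetrizer_mul_self (lam : t.Partition) :
    youngSymmetrizer lam * youngSymmetrizer lam = youngScalar lam • youngSymmetrizer lam :=
  (exists_youngSymmetrizer_mul_self lam).choose_spec.2

/-- A nonzero multiple of the central idempotent attached to `lam`. -/
noncomputable def centralElement (lam : t.Partition) : MonoidAlgebra ℂ (Equiv.Perm (Fin t)) :=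
  conjSum (youngSymmetrizer lam)

theorem coeff_centralElement_one (lam : t.Partition) :
    (centralElement lam).coeff 1 = t.factorial := by
  rw [centralElement, coeff_conjSum_one, coeff_youngSymmetrizer_one, mul_one, Fintype.card_perm,
    Fintype.card_fin]

theorem coeff_centralElement_one_ne_zero (lam : t.Partition) :
    (centralElement lam).coeff 1 ≠ 0 := by
  rw [coeff_centralElement_one]
  exact_mod_cast t.factorial_ne_zero

theorem centralElement_ne_zero (lam : t.Partition) : centralElement lam ≠ 0 := fun h =>
  coeff_centralElement_one_ne_zero lam (by rw [h]; rfl)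

theorem isConj_inv (σ : Equiv.Perm (Fin t)) : IsConj σ⁻¹ σ :=
  Equiv.Perm.isConj_iff_cycleType_eq.2 (Equiv.Perm.cycleType_inv σ)

theorem coeff_centralElement_inv (lam : t.Partition) (σ : Equiv.Perm (Fin t)) :
    (centralElement lam).coeff σ⁻¹ = (centralElement lam).coeff σ := by
  obtain ⟨u, hu⟩ := isConj_iff.1 (isConj_inv σ)
  conv_rhs => rw [← hu]
  exact (coeff_conjSum_conj _ _ _).symm

theorem centralElement_mul_self (lam : t.Partition) :
    centralElement lam * centralElement lam = youngScalar lam ^ 2 • centralElement lam :=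
  conjSum_mul_self (youngScalar_ne_zero lam) (coeff_youngSymmetrizer_one lam)
    (youngSymmetrizer_mul_self lam) (youngSymmetrizer_mul_mul_self lam)

theorem centralElement_mul_eq_zero {lam mu : t.Partition} (h : lam ≠ mu) :
    centralElement lam * centralElement mu = 0 :=
  conjSum_youngSymmetrizer_mul_eq_zero h

theorem youngScalar_mul_chi (lam : t.Partition) (σ : Equiv.Perm (Fin t)) :
    youngScalar lam * chi lam σ = (centralElement lam).coeff σ := by
  rw [← coeff_centralElement_inv]
  exact trace_lsmul_span_singleton (youngSymmetrizer_mul_self lam) σ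

theorem chi_eq (lam : t.Partition) (σ : Equiv.Perm (Fin t)) :
    chi lam σ = (centralElement lam).coeff σ / youngScalar lam := by
  rw [← youngScalar_mul_chi, mul_div_cancel_left₀ _ (youngScalar_ne_zero lam)]

theorem chi_one_ne_zero (lam : t.Partition) : chi lam 1 ≠ 0 := by
  rw [chi_eq]
  exact div_ne_zero (coeff_centralElement_one_ne_zero lam) (youngScalar_ne_zero lam)

theorem chi_conj (lam : t.Partition) (σ ρ : Equiv.Perm (Fin t)) :
    chi lam (ρ * σ * ρ⁻¹) = chi lam σ := by
  rw [chi_eq, chi_eq, centralElement, coeff_conjSum_conj]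

/-- A dimension count: the orthogonal elements `z_λ` are independent class functions, and the cycle
type bounds the dimension by the number of partitions. -/
theorem span_centralElement : Submodule.span ℂ (Set.range (centralElement (t := t))) =
    classFunctions (Equiv.Perm (Fin t)) := by
  have : FiniteDimensional ℂ (MonoidAlgebra ℂ (Equiv.Perm (Fin t))) :=
    (MonoidAlgebra.basis (Equiv.Perm (Fin t)) ℂ).finiteDimensional_of_finite
  have hli : LinearIndependent ℂ (centralElement (t := t)) :=
    linearIndependent_of_orthogonal centralElement_ne_zero
      (fun lam => pow_ne_zero 2 (youngScalar_ne_zero lam)) centralElement_mul_self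
      fun _ _ h => centralElement_mul_eq_zero h
  refine Submodule.eq_of_le_of_finrank_le ?_ ?_
  · rw [Submodule.span_le]
    rintro _ ⟨lam, rfl⟩
    exact coeff_conjSum_conj _
  · rw [finrank_span_eq_card hli]
    have h := finrank_classFunctions_le (G := Equiv.Perm (Fin t)) Equiv.Perm.partition
      fun g h hgh => Equiv.Perm.partition_eq_of_isConj.2 hgh
    rwa [show Fintype.card (Fintype.card (Fin t)).Partition = Fintype.card t.Partition by
      rw [Fintype.card_fin]] at h

theorem sum_centralElement :
    ∑ lam : t.Partition, (youngScalar lam ^ 2)⁻¹ • centralElement lam = 1 := by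
  refine sum_inv_smul_eq_one centralElement_ne_zero centralElement_mul_self
    (fun _ _ h => centralElement_mul_eq_zero h) ?_
  rw [span_centralElement]
  intro g h
  classical
  simp [one_def, Finsupp.single_apply, eq_comm (a := (1 : Equiv.Perm (Fin t)))]

/-- The sum of the permutations with `k` cycles. -/
noncomputable def cycleSum (t k : ℕ) : MonoidAlgebra ℂ (Equiv.Perm (Fin t)) :=
  ∑ σ : Equiv.Perm (Fin t) with numCycles σ = k, single σ 1

theorem numCycles_eq_of_isConj {σ τ : Equiv.Perm (Fin t)} (h : IsConj σ τ) :
    numCycles σ = numCycles τ := by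
  rw [numCycles, numCycles, Equiv.Perm.partition_eq_of_isConj.1 h]

theorem coeff_cycleSum (k : ℕ) (σ : Equiv.Perm (Fin t)) :
    (cycleSum t k).coeff σ = if numCycles σ = k then 1 else 0 := by
  classical
  rw [cycleSum, coeff_sum, Finsupp.finsetSum_apply]
  simp [Finsupp.single_apply, Finset.sum_ite_eq']

theorem cycleSum_mul_centralElement (k : ℕ) (lam : t.Partition) :
    cycleSum t k * centralElement lam =
      (∑ σ : Equiv.Perm (Fin t) with numCycles σ = k, chi lam σ / chi lam 1) •
        centralElement lam := by
  have hmem : cycleSum t k ∈ Submodule.span ℂ (Set.range (centralElement (t := t))) := by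
    rw [span_centralElement]
    intro g h
    rw [coeff_cycleSum, coeff_cycleSum,
      numCycles_eq_of_isConj (isConj_iff.2 ⟨h, rfl⟩ : IsConj g (h * g * h⁻¹))]
  obtain ⟨s, hs⟩ := exists_smul_of_mem_span centralElement_mul_self
    (fun _ _ h => centralElement_mul_eq_zero h) hmem lam
  rw [hs]
  congr 1
  -- The eigenvalue is found by comparing coefficients at the identity; `σ⁻¹` may be replaced by `σ`
  -- because the two are conjugate.
  have h1 : (cycleSum t k * centralElement lam).coeff 1 =
      ∑ σ : Equiv.Perm (Fin t) with numCycles σ = k, (centralElement lam).coeff σ := by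
    rw [cycleSum, Finset.sum_mul, coeff_sum, Finsupp.finsetSum_apply]
    refine Finset.sum_congr rfl fun σ _ => ?_
    rw [coeff_single_mul_apply, one_mul, mul_one, coeff_centralElement_inv]
  rw [hs, coeff_smul_apply, smul_eq_mul] at h1
  rw [eq_div_of_mul_eq (coeff_centralElement_one_ne_zero lam) h1, Finset.sum_div]
  refine Finset.sum_congr rfl fun σ _ => ?_
  rw [chi_eq, chi_eq, div_div_div_cancel_right₀ (youngScalar_ne_zero lam)]

end SymmetricGroup

/-! ### Nonvanishing of `f_λ`, extension of scalars to `ℂ(N)`, and the inverse. -/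

namespace SymmetricGroup

open MonoidAlgebra

variable {t : ℕ}

theorem numCycles_one : numCycles (1 : Equiv.Perm (Fin t)) = t := by
  simp [numCycles, Equiv.Perm.parts_partition]

/-- Having `t` cycles makes the number of nontrivial cycles equal to the size of the support, but
each such cycle moves at least two points, so there are none. -/
theorem eq_one_of_numCycles_eq {σ : Equiv.Perm (Fin t)} (h : numCycles σ = t) : σ = 1 := by
  rw [numCycles, Equiv.Perm.parts_partition, Multiset.card_add, Multiset.card_replicate,
    Fintype.card_fin] at h
  have h1 : Multiset.card σ.cycleType • 2 ≤ σ.cycleType.sum :=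
    Multiset.card_nsmul_le_sum fun _ hx => Equiv.Perm.two_le_of_mem_cycleType hx
  rw [Equiv.Perm.sum_cycleType, smul_eq_mul] at h1
  have h2 : σ.support.card ≤ t := by simpa using Finset.card_le_univ σ.support
  rw [← Equiv.Perm.cycleType_eq_zero, ← Multiset.card_eq_zero]
  omega

theorem numCycles_le (σ : Equiv.Perm (Fin t)) : numCycles σ ≤ t := by
  have h := Multiset.card_nsmul_le_sum (s := σ.partition.parts) (a := 1) fun _ hx =>
    σ.partition.parts_pos hx
  rw [σ.partition.parts_sum, smul_eq_mul, mul_one] at h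
  exact h.trans_eq (Fintype.card_fin t)

theorem coeff_fPoly_self (lam : t.Partition) : (fPoly lam).coeff t = 1 := by
  simp only [fPoly, Polynomial.finsetSum_coeff, Polynomial.coeff_C_mul, Polynomial.coeff_X_pow]
  rw [Finset.sum_eq_single 1]
  · rw [numCycles_one, if_pos rfl, mul_one, div_self (chi_one_ne_zero lam)]
  · intro σ _ hσ
    rw [if_neg fun h => hσ (eq_one_of_numCycles_eq h.symm), mul_zero]
  · simp

theorem fPoly_ne_zero (lam : t.Partition) : fPoly lam ≠ 0 := fun h => by
  simpa [h] using coeff_fPoly_self lam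

theorem coeff_toGroupAlgebra (F : Equiv.Perm (Fin t) → RatFunc ℂ) (σ : Equiv.Perm (Fin t)) :
    (toGroupAlgebra F).coeff σ = F σ := by
  classical
  rw [toGroupAlgebra, coeff_sum, Finsupp.finsetSum_apply]
  simp [Finsupp.single_apply]

theorem vFun_conj (σ ρ : Equiv.Perm (Fin t)) : vFun t (ρ * σ * ρ⁻¹) = vFun t σ := by
  simp only [vFun, chi_conj]

/-- Extension of scalars from `ℂ[S_t]` to `ℂ(N)[S_t]`. -/
noncomputable def extendScalars (t : ℕ) : MonoidAlgebra ℂ (Equiv.Perm (Fin t)) →+*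
    MonoidAlgebra (RatFunc ℂ) (Equiv.Perm (Fin t)) :=
  mapRingHom _ RatFunc.C

theorem extendScalars_smul (s : ℂ) (x : MonoidAlgebra ℂ (Equiv.Perm (Fin t))) :
    extendScalars t (s • x) = (RatFunc.C s : RatFunc ℂ) • extendScalars t x := by
  ext σ
  simp [extendScalars]

/-- Grouping by the number of cycles isolates the powers of `N`, so that the eigenvalues on `z_λ`
can be computed over `ℂ`. -/
theorem toGroupAlgebra_cycleFun : toGroupAlgebra (cycleFun t) =
    ∑ k ∈ Finset.range (t + 1), (RatFunc.X ^ k : RatFunc ℂ) • extendScalars t (cycleSum t k) := by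
  rw [toGroupAlgebra, ← Finset.sum_fiberwise_of_maps_to (g := numCycles)
    (t := Finset.range (t + 1)) fun σ _ => Finset.mem_range_succ_iff.2 (numCycles_le σ)]
  refine Finset.sum_congr rfl fun k _ => ?_
  rw [cycleSum, map_sum, Finset.smul_sum]
  refine Finset.sum_congr rfl fun σ hσ => ?_
  rw [cycleFun, (Finset.mem_filter.1 hσ).2]
  simp [extendScalars]

theorem algebraMap_fPoly (lam : t.Partition) :
    algebraMap (Polynomial ℂ) (RatFunc ℂ) (fPoly lam) =
      ∑ k ∈ Finset.range (t + 1), RatFunc.X ^ k * RatFunc.C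
        (∑ σ : Equiv.Perm (Fin t) with numCycles σ = k, chi lam σ / chi lam 1) := by
  rw [fPoly, map_sum, ← Finset.sum_fiberwise_of_maps_to (g := numCycles)
    (t := Finset.range (t + 1)) fun σ _ => Finset.mem_range_succ_iff.2 (numCycles_le σ)]
  refine Finset.sum_congr rfl fun k _ => ?_
  rw [map_sum, Finset.mul_sum]
  refine Finset.sum_congr rfl fun σ hσ => ?_
  rw [(Finset.mem_filter.1 hσ).2, map_mul, map_pow, RatFunc.algebraMap_X, RatFunc.algebraMap_C,
    mul_comm]

theorem toGroupAlgebra_cycleFun_mul (lam : t.Partition) :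
    toGroupAlgebra (cycleFun t) * extendScalars t (centralElement lam) =
      algebraMap (Polynomial ℂ) (RatFunc ℂ) (fPoly lam) •
        extendScalars t (centralElement lam) := by
  rw [toGroupAlgebra_cycleFun, algebraMap_fPoly, Finset.sum_mul, Finset.sum_smul]
  refine Finset.sum_congr rfl fun k _ => ?_
  rw [smul_mul_assoc, ← map_mul, cycleSum_mul_centralElement, extendScalars_smul, smul_smul]

theorem toGroupAlgebra_vFun : toGroupAlgebra (vFun t) =
    ∑ lam : t.Partition, (algebraMap (Polynomial ℂ) (RatFunc ℂ) (fPoly lam))⁻¹ •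
      extendScalars t ((youngScalar lam ^ 2)⁻¹ • centralElement lam) := by
  ext σ
  rw [coeff_toGroupAlgebra, coeff_sum, Finsupp.finsetSum_apply, vFun]
  refine Finset.sum_congr rfl fun lam _ => ?_
  have ht : (t.factorial : ℂ) ≠ 0 := by exact_mod_cast t.factorial_ne_zero
  -- Both characters contribute a factor `n_λ⁻¹`, and `z_λ(e) = t!` cancels the factorial in the
  -- definition of `V`.
  have h : chi lam 1 * chi lam σ =
      t.factorial * ((youngScalar lam ^ 2)⁻¹ * (centralElement lam).coeff σ) := by
    rw [chi_eq, chi_eq, coeff_centralElement_one]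
    field_simp [youngScalar_ne_zero lam]
  have h2 := congrArg (RatFunc.C : ℂ →+* RatFunc ℂ) h
  rw [map_mul, map_mul, map_natCast] at h2
  have ht2 : (t.factorial : RatFunc ℂ) ≠ 0 := by exact_mod_cast t.factorial_ne_zero
  rw [coeff_smul_apply, extendScalars, coeff_mapRingHom, coeff_smul_apply, smul_eq_mul,
    smul_eq_mul, div_mul_eq_mul_div, h2, mul_div_mul_left _ _ ht2, div_eq_inv_mul]

theorem toGroupAlgebra_cycleFun_mul_vFun :
    toGroupAlgebra (cycleFun t) * toGroupAlgebra (vFun t) = 1 := by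
  rw [toGroupAlgebra_vFun, Finset.mul_sum, ← map_one (extendScalars t), ← sum_centralElement,
    map_sum]
  refine Finset.sum_congr rfl fun lam _ => ?_
  have h : algebraMap (Polynomial ℂ) (RatFunc ℂ) (fPoly lam) ≠ 0 := by
    simpa using fPoly_ne_zero lam
  rw [extendScalars_smul, mul_smul_comm, mul_smul_comm, toGroupAlgebra_cycleFun_mul, smul_comm,
    smul_smul _ _ (extendScalars t _), smul_smul _ _ (extendScalars t _),
    inv_mul_cancel₀ h, mul_one]

/-- `V` is a class function, hence central, so the right inverse is also a left inverse. -/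
theorem toGroupAlgebra_vFun_mul_cycleFun :
    toGroupAlgebra (vFun t) * toGroupAlgebra (cycleFun t) = 1 := by
  rw [← mul_comm_of_coeff_conj (z := toGroupAlgebra (vFun t)) (fun σ ρ => by
    rw [coeff_toGroupAlgebra, coeff_toGroupAlgebra, vFun_conj]), toGroupAlgebra_cycleFun_mul_vFun]

end SymmetricGroup

theorem mainTheorem2 (t : ℕ) :
    (∀ lam : t.Partition, SymmetricGroup.fPoly lam ≠ 0) ∧
    (∀ σ ρ : Equiv.Perm (Fin t),
      SymmetricGroup.vFun t (ρ * σ * ρ⁻¹) = SymmetricGroup.vFun t σ) ∧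
    SymmetricGroup.toGroupAlgebra (SymmetricGroup.vFun t) *
      SymmetricGroup.toGroupAlgebra (SymmetricGroup.cycleFun t) = 1 ∧
    SymmetricGroup.toGroupAlgebra (SymmetricGroup.cycleFun t) *
      SymmetricGroup.toGroupAlgebra (SymmetricGroup.vFun t) = 1 :=
  ⟨SymmetricGroup.fPoly_ne_zero, SymmetricGroup.vFun_conj,
    SymmetricGroup.toGroupAlgebra_vFun_mul_cycleFun,
    SymmetricGroup.toGroupAlgebra_cycleFun_mul_vFun⟩
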